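/- Consider a slotted-time quantum switch with users $1,\dots,N$, requests $1,\dots,R$ and $M$ memory registers. Request $r$ corresponds to a set $\mathcal G(r)$ of users, distinct requests having distinct sets; $|\mathcal G(r)|$ is its cardinality, $\Lambda=\{|\mathcal G(r)| : 1\le r\le R\}$, and $\mathcal C(\lambda)=\{r : |\mathcal G(r)|=\lambda\}$. In each slot $t=1,2,\dots$ a set of requests is scheduled. If $r$ is scheduled, each user $i\in\mathcal G(r)$ attempts to establish a link for $r$, which succeeds with probability $p_i\in(0,1]$; if all of these links are established, a swapping operation is attempted, which succeeds with probability $q_\lambda\in(0,1]$, where $\lambda=|\mathcal G(r)|$. All these attempts are independent of each other, of the scheduling decision for the slot and of the past. Request $r$ is served in slot $t$ if it is scheduled, all its links are established and the swap succeeds. Put $v(r)=\prod_{i\in\mathcal G(r)}p_i$. The age of $r$ in slot $t$ is $h_r(t)=t-\sup\{\tau\in\{1,\dots,t-1\} : r \text{ is served in slot }\tau\}$, with $\sup\emptyset=0$, and the average age of $r$ is $$\Delta_r=\limsup_{T\to\infty}\frac1T\sum_{t=1}^T\mathbb E[h_r(t)]\in[0,\infty].$$ Let $\Lambda^{(1)},\dots,\Lambda^{(n)}\subseteq\Lambda$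 be maximal feasible, that is, $\sum_{\lambda\in\Lambda^{(i)}}\lambda\le M$, and $\sum_{\lambda\in\Lambda^{(i)}}\lambda+\lambda'>M$ for all $\lambda'\in\Lambda\setminus\Lambda^{(i)}$. The multi-cardinality max-age (MMA) policy given by a probability distribution $\phi$ on $\{1,\dots,n\}$ samples in each slot, independently of the past, an index $j$ from $\phi$, and schedules for each $\lambda\in\Lambda^{(j)}$ one request of $\mathcal C(\lambda)$ whose current age is the largest in $\mathcal C(\lambda)$; ties are broken by any causal (possibly randomized) rule. Then for every MMA policy, every $\lambda\in\Lambda$ and every $r\in\mathcal C(\lambda)$, $$\Delta_r=\frac{1}{2\theta_\lambda q_\lambda}\left(\frac1{\beta_\lambda}\sum_{r'\in\mathcal C(\lambda)}\frac1{v(r')^2}+\beta_\lambda\right),\qquad \theta_\lambda=\sum_{i:\,\lambda\in\Lambda^{(i)}}\phi(i),\quad \beta_\lambda=\sum_{r'\in\mathcal C(\lambda)}\frac1{v(r')},$$ where the right-hand side is $\infty$ if $\theta_\lambda=0$. In particular, all requests of the same cardinality have the same average age. -/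

import Mathlib

open MeasureTheory ProbabilityTheory
open scoped ENNReal

/-- A quantum switch with `N` users and `R` requests in a star topology. Request `r` asks for
entanglement among the users `users r`; distinct requests have distinct user sets. The switch has
`memory` registers, a link-level entanglement (LLE) attempt of user `i` succeeds with probability
`p i`, and a swap for a request of cardinality `l` succeeds with probability `q l`. -/
structure QuantumSwitch (N R : ℕ) where
  users : Fin R → Finset (Fin N)
  users_injective : Function.Injective users
  memory : ℕ
  p : Fin N → ℝ
  p_mem : ∀ i, p i ∈ Set.Ioc (0 : ℝ) 1
  q : ℕ → ℝ
  q_mem : ∀ r, q (users r).card ∈ Set.Ioc (0 : ℝ) 1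

namespace QuantumSwitch

variable {N R : ℕ} (sw : QuantumSwitch N R)

/-- The set of distinct request cardinalities. -/
def cards : Finset ℕ := Finset.univ.image fun r => (sw.users r).card

/-- The set of requests of cardinality `l`. -/
def requests (l : ℕ) : Finset (Fin R) := Finset.univ.filter fun r => (sw.users r).card = l

/-- The probability that all users of `r` establish their LLEs in a slot in which `r` is
scheduled. -/
def v (r : Fin R) : ℝ := ∏ i ∈ sw.users r, sw.p i

/-- `L` is a maximal feasible subset of cardinalities. -/
def IsMaximalFeasible (L : Finset ℕ) : Prop :=
  L ⊆ sw.cards ∧ (∑ l ∈ L, l) ≤ sw.memory ∧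
    ∀ l' ∈ sw.cards \ L, sw.memory < (∑ l ∈ L, l) + l'

/-- The sum of `1 / v r'` over the requests `r'` of cardinality `l`. -/
noncomputable def beta (l : ℕ) : ℝ := ∑ r' ∈ sw.requests l, 1 / sw.v r'

end QuantumSwitch

/-- The total probability of the cardinality subsets that contain `l`. -/
def theta {n : ℕ} (subsets : Fin n → Finset ℕ) (φ : Fin n → ℝ) (l : ℕ) : ℝ :=
  ∑ i ∈ Finset.univ.filter (fun i => l ∈ subsets i), φ i

/-- The random quantities that drive the switch. Time slots are `t = 1, 2, …`.
* `index t` is the index sampled by the policy in slot `t`;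
* `choice t j l` is the request of cardinality `l` that the policy schedules in slot `t` when the
  sampled index is `j` (relevant only if `l` belongs to the `j`-th cardinality subset);
* `link t r i` is the outcome, if it is made, of the LLE attempt of user `i` for request `r`;
* `swap t r` is the outcome, if it is made, of the swapping attempt for request `r`. -/
structure SwitchRun (N R n : ℕ) (Ω : Type*) where
  index : ℕ → Ω → Fin n
  choice : ℕ → Fin n → ℕ → Ω → Fin R
  link : ℕ → Fin R → Fin N → Ω → Bool
  swap : ℕ → Fin R → Ω → Bool

/-- The sources of randomness in one slot: the past (before the slot), the sampled index, the LLE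
attempts and the swapping attempts. -/
inductive Source (N R : ℕ) : Type
  | past : Source N R
  | index : Source N R
  | link (r : Fin R) (i : Fin N) : Source N R
  | swap (r : Fin R) : Source N R

namespace SwitchRun

variable {N R n : ℕ} {Ω : Type*} (X : SwitchRun N R n Ω)

/-- Request `r` is scheduled in slot `t` : the memory configuration consists of the requests chosen
for the cardinalities in the sampled subset. -/
def Selected (subsets : Fin n → Finset ℕ) (t : ℕ) (r : Fin R) (ω : Ω) : Prop :=
  ∃ l ∈ subsets (X.index t ω), X.choice t (X.index t ω) l ω = r

/-- Request `r` is served in slot `t` : it is scheduled, all of its users establish their LLEs, and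
the swap succeeds. -/
def Served (sw : QuantumSwitch N R) (subsets : Fin n → Finset ℕ) (t : ℕ) (r : Fin R) (ω : Ω) :
    Prop :=
  X.Selected subsets t r ω ∧ (∀ i ∈ sw.users r, X.link t r i ω = true) ∧ X.swap t r ω = true

open Classical in
/-- The age of request `r` in slot `t` : the time since the last slot `1 ≤ τ < t` in which `r` was
served, and `t` if there is no such slot (the supremum of the empty set being `0`). -/
noncomputable def age (sw : QuantumSwitch N R) (subsets : Fin n → Finset ℕ) (r : Fin R) (t : ℕ)
    (ω : Ω) : ℕ :=
  t - ((Finset.Ico 1 t).filter fun τ => X.Served sw subsets τ r ω).sup id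

/-- The average age of request `r`, the upper limit of the time averages of its expected age. -/
noncomputable def averageAge [MeasurableSpace Ω] (P : Measure Ω) (sw : QuantumSwitch N R)
    (subsets : Fin n → Finset ℕ) (r : Fin R) : ℝ≥0∞ :=
  Filter.limsup
    (fun T : ℕ => (∑ t ∈ Finset.Icc 1 T, ∫⁻ ω, (X.age sw subsets r t ω : ℝ≥0∞) ∂P) / (T : ℝ≥0∞))
    Filter.atTop

/-- The sigma-algebras generated by the sources of randomness of slot `t`, where `past` is the
information available at the beginning of the slot. -/
@[reducible] def sigma (past : MeasurableSpace Ω) (t : ℕ) : Source N R → MeasurableSpace Ω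
  | .past => past
  | .index => MeasurableSpace.comap (X.index t) ⊤
  | .link r i => MeasurableSpace.comap (X.link t r i) ⊤
  | .swap r => MeasurableSpace.comap (X.swap t r) ⊤

/-- `X` is a run of the switch `sw` under the multi-cardinality max-age policy with cardinality
subsets `subsets` and sampling distribution `φ`. Here `ℱ t` is the information available at the
beginning of slot `t`; it contains the outcomes of all earlier slots and may contain further
randomness, which the policy can use to break ties between requests of equal age. -/
structure IsMMA [mΩ : MeasurableSpace Ω] (P : Measure Ω) (ℱ : Filtration ℕ mΩ)
    (sw : QuantumSwitch N R) (subsets : Fin n → Finset ℕ) (φ : Fin n → ℝ) : Prop where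
  index_measurable : ∀ t, 1 ≤ t → Measurable[ℱ (t + 1), ⊤] (X.index t)
  link_measurable : ∀ t, 1 ≤ t → ∀ r i, Measurable[ℱ (t + 1), ⊤] (X.link t r i)
  swap_measurable : ∀ t, 1 ≤ t → ∀ r, Measurable[ℱ (t + 1), ⊤] (X.swap t r)
  index_law : ∀ t, 1 ≤ t → ∀ j, P {ω | X.index t ω = j} = ENNReal.ofReal (φ j)
  link_law : ∀ t, 1 ≤ t → ∀ r i, P {ω | X.link t r i ω = true} = ENNReal.ofReal (sw.p i)
  swap_law : ∀ t, 1 ≤ t → ∀ r,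
    P {ω | X.swap t r ω = true} = ENNReal.ofReal (sw.q (sw.users r).card)
  indep : ∀ t, 1 ≤ t → iIndep (X.sigma (ℱ t) t) P
  choice_measurable : ∀ t, 1 ≤ t → ∀ j, ∀ l ∈ subsets j, Measurable[ℱ t, ⊤] (X.choice t j l)
  choice_mem : ∀ t, 1 ≤ t → ∀ j, ∀ l ∈ subsets j, ∀ ω, X.choice t j l ω ∈ sw.requests l
  choice_max : ∀ t, 1 ≤ t → ∀ j, ∀ l ∈ subsets j, ∀ ω, ∀ r' ∈ sw.requests l,
    X.age sw subsets r' t ω ≤ X.age sw subsets (X.choice t j l ω) t ω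

end SwitchRun

/-!
Fix a request `r` of cardinality `l`. Let `h` be its age and `S` the set of requests of cardinality
`l` that are at least as old as `r`. Under the max-age policy the pair `(h, S)` evolves almost
autonomously: if `c` is the oldest request of cardinality `l`, then it is served with probability
`1 / a c`, where `a c = 1 / (θ * q * v c)`, and a service removes `c` from `S` if `c ≠ r`, and
resets the pair to `h = 1` and the full class if `c = r`. Hence `r` is served after a sum of independent
geometric times, one for each member of `S`.

No renewal theory is needed: `agePotential a D h S`, the expected total of `age - D` until `r` is
served, solves the Poisson equation `E[next potential] - potential = D - h` exactly when a full
cycle has zero potential (`agePotential_cycle`), which determines `D`. Summing over the slots, the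
average of `E[h]` up to `T` is `D` up to a boundary term and an error term, divided by `T`.

* `SwitchRun.IsMMA.drift` computes one-step expectations. Conditionally on the past, the sampled
  index and the outcomes of the attempts are independent; as the tie-breaking rule may depend on the
  index, the formula is a sum over the indices.
* The Poisson equation fails only in slots in which `r` may be scheduled while another request is as
  old. Such ties occur only between requests that have never been served
  (`SwitchRun.IsMMA.eq_of_age_eq`), and then `h = t`, so the error is `O(h ^ 2 / t)`
  (`SwitchRun.IsMMA.abs_potential_drift_sub_le`).
* `SwitchRun.IsMMA.exists_second_moment_bound` bounds `E[h ^ 2]` uniformly in time by means of an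
  exponential Lyapunov function, which makes the error terms null and the potential bounded in mean.

If `θ = 0`, the age is `t` in mean, and its averages tend to infinity.
-/

/-! ### Integrals of finitely valued functions and of independent factors -/

/-- A function of a random element that takes finitely many values is integrable. -/
theorem integrable_comp_of_mem_finset {Ω β : Type*} [MeasurableSpace Ω] {P : Measure Ω}
    [IsProbabilityMeasure P] [MeasurableSpace β] [Countable β] [MeasurableSingletonClass β]
    {Y : Ω → β} (hY : Measurable Y) (s : Finset β) (hs : ∀ ω, Y ω ∈ s) (H : β → ℝ) :
    Integrable (fun ω => H (Y ω)) P := by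
  refine Integrable.of_bound ((measurable_of_countable H).comp hY).aestronglyMeasurable
    (∑ b ∈ s, |H b|) (.of_forall fun ω => ?_)
  exact Finset.single_le_sum (f := fun b => |H b|) (fun _ _ => abs_nonneg _) (hs ω)

/-- If the event `E` has conditional probability `c` given the sigma-algebra `m`, then so has it
under the weight of any `m`-measurable random variable. -/
theorem setIntegral_eq_mul_integral_of_indep {Ω : Type*} {m mΩ : MeasurableSpace Ω}
    {P : Measure Ω} (hm : m ≤ mΩ) {E : Set Ω} {c : ℝ}
    (hc : 0 ≤ c) (hE : ∀ A, MeasurableSet[m] A → P (A ∩ E) = P A * ENNReal.ofReal c)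
    {U : Ω → ℝ} (hU : Measurable[m] U) :
    ∫ ω in E, U ω ∂P = c * ∫ ω, U ω ∂P := by
  have hUs : StronglyMeasurable[m] U := hU.stronglyMeasurable
  have htrim : (P.restrict E).trim hm = ENNReal.ofReal c • P.trim hm := by
    refine @Measure.ext Ω m _ _ fun A hA => ?_
    rw [trim_measurableSet_eq hm hA, Measure.restrict_apply (hm A hA), hE A hA,
      Measure.smul_apply, trim_measurableSet_eq hm hA, smul_eq_mul, mul_comm]
  rw [integral_trim hm hUs, htrim, integral_smul_measure, ← integral_trim hm hUs,
    ENNReal.toReal_ofReal hc, smul_eq_mul]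

namespace QuantumSwitch

variable {N R : ℕ} (sw : QuantumSwitch N R)

theorem mem_requests {l : ℕ} {r : Fin R} : r ∈ sw.requests l ↔ (sw.users r).card = l := by
  simp [requests]

theorem v_pos (r : Fin R) : 0 < sw.v r := Finset.prod_pos fun i _ => (sw.p_mem i).1

theorem v_le_one (r : Fin R) : sw.v r ≤ 1 :=
  Finset.prod_le_one (fun i _ => (sw.p_mem i).1.le) fun i _ => (sw.p_mem i).2

theorem q_pos {l : ℕ} {r : Fin R} (hr : r ∈ sw.requests l) : 0 < sw.q l :=
  sw.mem_requests.1 hr ▸ (sw.q_mem r).1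

theorem q_le_one {l : ℕ} {r : Fin R} (hr : r ∈ sw.requests l) : sw.q l ≤ 1 :=
  sw.mem_requests.1 hr ▸ (sw.q_mem r).2

end QuantumSwitch

namespace SwitchRun

variable {N R n : ℕ} {Ω : Type*} (X : SwitchRun N R n Ω)

section Age

variable (sw : QuantumSwitch N R) (subsets : Fin n → Finset ℕ)

/-! ### Evolution of the ages -/

theorem age_one (r : Fin R) (ω : Ω) : X.age sw subsets r 1 ω = 1 := by
  simp [age]

open Classical in
theorem age_succ (r : Fin R) {t : ℕ} (ht : 1 ≤ t) (ω : Ω) :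
    X.age sw subsets r (t + 1) ω =
      if X.Served sw subsets t r ω then 1 else X.age sw subsets r t ω + 1 := by
  have hsup : ((Finset.Ico 1 t).filter fun τ => X.Served sw subsets τ r ω).sup id ≤ t :=
    Finset.sup_le fun τ hτ => (Finset.mem_Ico.1 (Finset.mem_filter.1 hτ).1).2.le
  unfold age
  rw [← Finset.insert_Ico_right_eq_Ico_add_one ht, Finset.filter_insert]
  split_ifs with hs
  · rw [Finset.sup_insert, id, sup_eq_left.2 hsup]
    omega
  · omega

theorem age_le (r : Fin R) (t : ℕ) (ω : Ω) : X.age sw subsets r t ω ≤ t := Nat.sub_le _ _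

theorem one_le_age (r : Fin R) {t : ℕ} (ht : 1 ≤ t) (ω : Ω) : 1 ≤ X.age sw subsets r t ω := by
  induction t, ht using Nat.le_induction with
  | base => rw [age_one]
  | succ t ht ih =>
    rw [age_succ _ _ _ _ ht]
    split_ifs <;> omega

/-- The requests of cardinality `l` that are at least as old as `r`. Under the max-age policy these
are `r` itself and the requests to be served before `r`, except that `r` may be served before other
requests that have never been served. -/
noncomputable def ahead (l : ℕ) (r : Fin R) (t : ℕ) (ω : Ω) : Finset (Fin R) :=
  (sw.requests l).filter fun c => X.age sw subsets r t ω ≤ X.age sw subsets c t ω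

/-- The change of a function `G` of the age of `r` and of the set `ahead`, relative to a slot
without service, if request `c` is served when the age of `r` is `h` and the set is `S`. -/
def jump (C : Finset (Fin R)) (r : Fin R) (G : ℕ → Finset (Fin R) → ℝ) (c : Fin R) (h : ℕ)
    (S : Finset (Fin R)) : ℝ :=
  (if c = r then G 1 C else G (h + 1) (S.erase c)) - G (h + 1) S

end Age

namespace IsMMA

variable {X} [mΩ : MeasurableSpace Ω] {P : Measure Ω} {ℱ : Filtration ℕ mΩ}
  {sw : QuantumSwitch N R} {subsets : Fin n → Finset ℕ} {φ : Fin n → ℝ}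

theorem served_iff (hX : X.IsMMA P ℱ sw subsets φ) {t : ℕ} (ht : 1 ≤ t) {l : ℕ} {c : Fin R}
    (hc : c ∈ sw.requests l) (ω : Ω) :
    X.Served sw subsets t c ω ↔ l ∈ subsets (X.index t ω) ∧
      X.choice t (X.index t ω) l ω = c ∧ (∀ i ∈ sw.users c, X.link t c i ω = true) ∧
        X.swap t c ω = true := by
  constructor
  · rintro ⟨⟨l', hl', hc'⟩, h⟩
    have := hX.choice_mem t ht _ l' hl' ω
    rw [hc', sw.mem_requests] at this
    rw [sw.mem_requests] at hc
    obtain rfl : l = l' := hc.symm.trans this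
    exact ⟨hl', hc', h⟩
  · rintro ⟨hl, hc', h⟩
    exact ⟨⟨l, hl, hc'⟩, h⟩

/-- At most one request of each cardinality is served in a slot. -/
theorem served_unique (hX : X.IsMMA P ℱ sw subsets φ) {t : ℕ} (ht : 1 ≤ t) {l : ℕ} {c d : Fin R}
    (hc : c ∈ sw.requests l) (hd : d ∈ sw.requests l) {ω : Ω} (h : X.Served sw subsets t c ω)
    (h' : X.Served sw subsets t d ω) : c = d := by
  rw [← ((hX.served_iff ht hc ω).1 h).2.1, ← ((hX.served_iff ht hd ω).1 h').2.1]

/-- Distinct requests of the same cardinality have the same age only if neither was ever served. -/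
theorem eq_of_age_eq (hX : X.IsMMA P ℱ sw subsets φ) {t : ℕ} (ht : 1 ≤ t) {l : ℕ} {c d : Fin R}
    (hc : c ∈ sw.requests l) (hd : d ∈ sw.requests l) {ω : Ω}
    (h : X.age sw subsets c t ω = X.age sw subsets d t ω) (hlt : X.age sw subsets c t ω < t) :
    c = d := by
  induction t, ht using Nat.le_induction with
  | base => simp [age_one] at hlt
  | succ t ht ih =>
    have h1 := X.one_le_age sw subsets c ht ω
    have h2 := X.one_le_age sw subsets d ht ω
    rw [age_succ _ _ _ _ ht] at h hlt
    rw [age_succ _ _ _ _ ht] at h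
    split_ifs at h hlt with hsc hsd hsd
    · exact hX.served_unique ht hc hd hsc hsd
    · omega
    · omega
    · exact ih (by omega) (by omega)

theorem choice_mem_ahead (hX : X.IsMMA P ℱ sw subsets φ) {t : ℕ} (ht : 1 ≤ t) {l : ℕ}
    {r : Fin R} (hr : r ∈ sw.requests l) {j : Fin n} (hj : l ∈ subsets j) (ω : Ω) :
    X.choice t j l ω ∈ X.ahead sw subsets l r t ω :=
  Finset.mem_filter.2 ⟨hX.choice_mem t ht j l hj ω, hX.choice_max t ht j l hj ω r hr⟩

/-- If `r` is scheduled and was served before, then no other request is as old as `r`. -/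
theorem ahead_erase_eq_empty (hX : X.IsMMA P ℱ sw subsets φ) {t : ℕ} (ht : 1 ≤ t) {l : ℕ}
    {r : Fin R} (hr : r ∈ sw.requests l) {j : Fin n} (hj : l ∈ subsets j) {ω : Ω}
    (hch : X.choice t j l ω = r) (hlt : X.age sw subsets r t ω < t) :
    (X.ahead sw subsets l r t ω).erase r = ∅ := by
  refine Finset.eq_empty_of_forall_notMem fun d hd => ?_
  obtain ⟨hdr, hd⟩ := Finset.mem_erase.1 hd
  obtain ⟨hdC, hle⟩ := Finset.mem_filter.1 hd
  have hge := hX.choice_max t ht j l hj ω d hdC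
  rw [hch] at hge
  exact hdr (hX.eq_of_age_eq ht hr hdC (le_antisymm hle hge) hlt).symm

open Classical in
/-- The evolution of a function of the age of `r` and of the set of requests ahead of `r`. -/
theorem step (hX : X.IsMMA P ℱ sw subsets φ) {t : ℕ} (ht : 1 ≤ t) {l : ℕ}
    {r : Fin R} (hr : r ∈ sw.requests l) (G : ℕ → Finset (Fin R) → ℝ) (ω : Ω) :
    G (X.age sw subsets r (t + 1) ω) (X.ahead sw subsets l r (t + 1) ω) =
      G (X.age sw subsets r t ω + 1) (X.ahead sw subsets l r t ω) +
        ∑ c ∈ sw.requests l, if X.Served sw subsets t c ω then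
          jump (sw.requests l) r G c (X.age sw subsets r t ω) (X.ahead sw subsets l r t ω)
          else 0 := by
  have h1 := X.one_le_age sw subsets r ht ω
  by_cases hs : ∃ c ∈ sw.requests l, X.Served sw subsets t c ω
  · obtain ⟨c, hc, hsc⟩ := hs
    rw [Finset.sum_eq_single_of_mem c hc fun d hd hdc =>
      if_neg fun hsd => hdc (hX.served_unique ht hd hc hsd hsc), if_pos hsc, jump,
      add_sub_cancel]
    split_ifs with hcr
    · subst hcr
      congr 1
      · rw [age_succ _ _ _ _ ht, if_pos hsc]
      · refine Finset.filter_true_of_mem fun d _ => ?_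
        rw [age_succ _ _ _ _ ht, if_pos hsc]
        exact X.one_le_age sw subsets d (by omega) ω
    · have hsr : ¬ X.Served sw subsets t r ω := fun hsr =>
        hcr (hX.served_unique ht hc hr hsc hsr)
      congr 1
      · rw [age_succ _ _ _ _ ht, if_neg hsr]
      · ext d
        simp only [ahead, Finset.mem_erase, Finset.mem_filter]
        rw [age_succ _ _ _ _ ht, if_neg hsr, age_succ _ _ _ _ ht]
        by_cases hdc : d = c
        · subst hdc
          simp only [if_pos hsc, ne_eq, not_true_eq_false, false_and, iff_false]
          omega
        · by_cases hd : d ∈ sw.requests l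
          · have hsd : ¬ X.Served sw subsets t d ω := fun hsd =>
              hdc (hX.served_unique ht hd hc hsd hsc)
            simp [hd, hdc, hsd]
          · simp [hd]
  · push Not at hs
    rw [Finset.sum_eq_zero fun c hc => if_neg (hs c hc), add_zero]
    congr 1
    · rw [age_succ _ _ _ _ ht, if_neg (hs r hr)]
    · refine Finset.filter_congr fun d hd => ?_
      rw [age_succ _ _ _ _ ht, if_neg (hs r hr), age_succ _ _ _ _ ht, if_neg (hs d hd)]
      omega

/-! ### Measurability and independence -/

theorem measurableSet_served (hX : X.IsMMA P ℱ sw subsets φ) {t : ℕ} (ht : 1 ≤ t) (c : Fin R) :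
    MeasurableSet[ℱ (t + 1)] {ω | X.Served sw subsets t c ω} := by
  have hle : ℱ t ≤ ℱ (t + 1) := ℱ.mono (Nat.le_succ t)
  have heq : {ω | X.Served sw subsets t c ω} =
      (⋃ j, ⋃ l ∈ subsets j, (X.index t ⁻¹' {j} ∩ X.choice t j l ⁻¹' {c})) ∩
        ((⋂ i ∈ sw.users c, X.link t c i ⁻¹' {true}) ∩ X.swap t c ⁻¹' {true}) := by
    ext ω
    simp [Served, Selected]
  rw [heq]
  refine MeasurableSet.inter (.iUnion fun j => Finset.measurableSet_biUnion _ fun l hl =>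
    .inter (hX.index_measurable t ht trivial) (hle _ (hX.choice_measurable t ht j l hl trivial)))
    (.inter (Finset.measurableSet_biInter _ fun i _ => hX.link_measurable t ht c i trivial)
      (hX.swap_measurable t ht c trivial))

theorem measurable_age (hX : X.IsMMA P ℱ sw subsets φ) {t : ℕ} (ht : 1 ≤ t) (c : Fin R) :
    Measurable[ℱ t] (X.age sw subsets c t) := by
  classical
  induction t, ht using Nat.le_induction with
  | base =>
    rw [show X.age sw subsets c 1 = fun _ => 1 from funext (X.age_one sw subsets c)]
    exact measurable_const
  | succ t ht ih =>
    rw [show X.age sw subsets c (t + 1) = fun ω => if X.Served sw subsets t c ω then 1 else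
      X.age sw subsets c t ω + 1 from funext (X.age_succ sw subsets c ht)]
    have ih' : Measurable[ℱ (t + 1)] (X.age sw subsets c t) :=
      ih.mono (ℱ.mono (Nat.le_succ t)) le_rfl
    exact Measurable.ite (hX.measurableSet_served ht c) measurable_const (ih'.add_const 1)

theorem measurable_ages (hX : X.IsMMA P ℱ sw subsets φ) {t : ℕ} (ht : 1 ≤ t) :
    Measurable[ℱ t] fun ω c => X.age sw subsets c t ω :=
  @measurable_pi_lambda _ _ _ (ℱ t) _ _ fun c => hX.measurable_age ht c

/-- Every function of the age of `r` and of the requests ahead of `r` is a random variable. -/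
theorem measurable_state (hX : X.IsMMA P ℱ sw subsets φ) {t : ℕ} (ht : 1 ≤ t) (l : ℕ)
    (r : Fin R) (G : ℕ → Finset (Fin R) → ℝ) :
    Measurable[ℱ t] fun ω => G (X.age sw subsets r t ω) (X.ahead sw subsets l r t ω) :=
  (measurable_of_countable fun a : Fin R → ℕ =>
    G (a r) ((sw.requests l).filter fun c => a r ≤ a c)).comp (hX.measurable_ages ht)

theorem integrable_state [IsProbabilityMeasure P] (hX : X.IsMMA P ℱ sw subsets φ) {t : ℕ}
    (ht : 1 ≤ t) (l : ℕ) (r : Fin R) (G : ℕ → Finset (Fin R) → ℝ) :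
    Integrable (fun ω => G (X.age sw subsets r t ω) (X.ahead sw subsets l r t ω)) P :=
  integrable_comp_of_mem_finset ((hX.measurable_ages ht).mono (ℱ.le t) le_rfl)
    (Fintype.piFinset fun _ => Finset.range (t + 1))
    (fun ω => Fintype.mem_piFinset.2 fun c => Finset.mem_range.2
      (Nat.lt_succ_of_le (X.age_le sw subsets c t ω)))
    fun a : Fin R → ℕ => G (a r) ((sw.requests l).filter fun c => a r ≤ a c)

theorem integrable_choice_state [IsProbabilityMeasure P] (hX : X.IsMMA P ℱ sw subsets φ) {t : ℕ}
    (ht : 1 ≤ t) {l : ℕ} (r : Fin R) {j : Fin n} (hj : l ∈ subsets j)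
    (G : Fin R → ℕ → Finset (Fin R) → ℝ) :
    Integrable (fun ω => G (X.choice t j l ω) (X.age sw subsets r t ω)
      (X.ahead sw subsets l r t ω)) P := by
  have hch : Measurable (X.choice t j l) :=
    (hX.choice_measurable t ht j l hj).mono (ℱ.le t) le_top
  have hag : Measurable fun ω c => X.age sw subsets c t ω :=
    (hX.measurable_ages ht).mono (ℱ.le t) le_rfl
  exact integrable_comp_of_mem_finset (hch.prodMk hag)
    (Finset.univ ×ˢ Fintype.piFinset fun _ => Finset.range (t + 1))
    (fun ω => Finset.mem_product.2 ⟨Finset.mem_univ _, Fintype.mem_piFinset.2 fun c =>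
      Finset.mem_range.2 (Nat.lt_succ_of_le (X.age_le sw subsets c t ω))⟩)
    fun a : Fin R × (Fin R → ℕ) => G a.1 (a.2 r) ((sw.requests l).filter fun c => a.2 r ≤ a.2 c)

/-- In slot `t` the index `j` is sampled and all attempts for `c`, if made, succeed. -/
def success (X : SwitchRun N R n Ω) (sw : QuantumSwitch N R) (t : ℕ) (j : Fin n) (c : Fin R) :
    Set Ω :=
  X.index t ⁻¹' {j} ∩ (X.swap t c ⁻¹' {true} ∩ ⋂ i ∈ sw.users c, X.link t c i ⁻¹' {true})

theorem measurableSet_success (hX : X.IsMMA P ℱ sw subsets φ) {t : ℕ} (ht : 1 ≤ t) (j : Fin n)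
    (c : Fin R) : MeasurableSet (success X sw t j c) :=
  ℱ.le (t + 1) _ <| .inter (hX.index_measurable t ht trivial)
    (.inter (hX.swap_measurable t ht c trivial)
      (Finset.measurableSet_biInter _ fun i _ => hX.link_measurable t ht c i trivial))

theorem measure_inter_success (hX : X.IsMMA P ℱ sw subsets φ) (hφ : ∀ j, 0 ≤ φ j) {t : ℕ}
    (ht : 1 ≤ t) {l : ℕ} (j : Fin n) {c : Fin R} (hc : c ∈ sw.requests l) {A : Set Ω}
    (hA : MeasurableSet[ℱ t] A) :
    P (A ∩ success X sw t j c) = P A * ENNReal.ofReal (φ j * (sw.q l * sw.v c)) := by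
  classical
  have hlink : Function.Injective (Source.link (N := N) c) := fun a b h => by simpa using h
  let f : Source N R → Set Ω
    | .past => A
    | .index => X.index t ⁻¹' {j}
    | .link c i => X.link t c i ⁻¹' {true}
    | .swap c => X.swap t c ⁻¹' {true}
  have hf : ∀ s, MeasurableSet[X.sigma (ℱ t) t s] (f s)
    | .past => hA
    | .index => ⟨{j}, trivial, rfl⟩
    | .link c i => ⟨{true}, trivial, rfl⟩
    | .swap c => ⟨{true}, trivial, rfl⟩
  have key := (hX.indep t ht).meas_biInter (S := insert .past (insert .index (insert (.swap c)
    ((sw.users c).image (.link c))))) (s := f) (fun s _ => hf s)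
  rw [Finset.prod_insert (by simp), Finset.prod_insert (by simp), Finset.prod_insert (by simp),
    Finset.prod_image hlink.injOn] at key
  simp only [Finset.set_biInter_insert, Finset.set_biInter_finset_image] at key
  have h1 : P (X.index t ⁻¹' {j}) = ENNReal.ofReal (φ j) := hX.index_law t ht j
  have h2 : P (X.swap t c ⁻¹' {true}) = ENNReal.ofReal (sw.q l) :=
    sw.mem_requests.1 hc ▸ hX.swap_law t ht c
  have h3 : ∀ i, P (X.link t c i ⁻¹' {true}) = ENNReal.ofReal (sw.p i) :=
    fun i => hX.link_law t ht c i
  refine key.trans ?_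
  simp only [f, h1, h2, h3]
  rw [QuantumSwitch.v, ENNReal.ofReal_mul (hφ j), ENNReal.ofReal_mul (sw.q_pos hc).le,
    ENNReal.ofReal_prod_of_nonneg fun i _ => (sw.p_mem i).1.le]

open Classical in
/-- The conditional probability that `c` is served, given the past, is the sum of `φ j * q l * v c`
over the indices `j` for which the policy would schedule `c`. -/
theorem integral_served [IsProbabilityMeasure P] (hX : X.IsMMA P ℱ sw subsets φ)
    (hφ : ∀ j, 0 ≤ φ j) {t : ℕ} (ht : 1 ≤ t) {l : ℕ} {c : Fin R} (hc : c ∈ sw.requests l)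
    {U : Ω → ℝ} (hU : Measurable[ℱ t] U) (hUi : Integrable U P) :
    ∫ ω, (if X.Served sw subsets t c ω then U ω else 0) ∂P =
      ∑ j ∈ Finset.univ.filter (fun j => l ∈ subsets j), φ j * (sw.q l * sw.v c) *
        ∫ ω, (if X.choice t j l ω = c then U ω else 0) ∂P := by
  have hm : ∀ j ∈ Finset.univ.filter (fun j => l ∈ subsets j),
      MeasurableSet[ℱ t] {ω | X.choice t j l ω = c} := fun j hj =>
    hX.choice_measurable t ht j l (Finset.mem_filter.1 hj).2
      (show MeasurableSet[⊤] ({c} : Set (Fin R)) from trivial)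
  -- the success events are disjoint for distinct indices, and only the sampled index contributes
  have hpt : ∀ ω, (if X.Served sw subsets t c ω then U ω else 0) =
      ∑ j ∈ Finset.univ.filter (fun j => l ∈ subsets j), (success X sw t j c).indicator
        (fun ω => if X.choice t j l ω = c then U ω else 0) ω := by
    intro ω
    have hz : ∀ j, j ≠ X.index t ω → (success X sw t j c).indicator
        (fun ω => if X.choice t j l ω = c then U ω else 0) ω = 0 := fun j hj =>
      Set.indicator_of_notMem (fun h => hj h.1.symm) _
    by_cases hl : l ∈ subsets (X.index t ω)
    · rw [Finset.sum_eq_single_of_mem (X.index t ω) (by simpa using hl) fun j _ => hz j]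
      by_cases hs : X.Served sw subsets t c ω
      · obtain ⟨-, h1, h2, h3⟩ := (hX.served_iff ht hc ω).1 hs
        rw [if_pos hs, Set.indicator_of_mem, if_pos h1]
        exact ⟨rfl, h3, Set.mem_iInter₂.2 h2⟩
      · rw [if_neg hs, Set.indicator_apply]
        split_ifs with h1 h2
        · exact absurd ((hX.served_iff ht hc ω).2 ⟨hl, h2,
            fun i hi => Set.mem_iInter₂.1 h1.2.2 i hi, h1.2.1⟩) hs
        · rfl
        · rfl
    · rw [Finset.sum_eq_zero, if_neg]
      · exact fun hs => hl ((hX.served_iff ht hc ω).1 hs).1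
      · intro j hj
        refine hz j ?_
        rintro rfl
        exact hl (Finset.mem_filter.1 hj).2
  have hi : ∀ j ∈ Finset.univ.filter (fun j => l ∈ subsets j),
      Integrable (fun ω => if X.choice t j l ω = c then U ω else 0) P := fun j hj =>
    (hUi.indicator (ℱ.le t _ (hm j hj))).congr (.of_forall fun ω => by simp [Set.indicator_apply])
  simp_rw [hpt]
  rw [integral_finsetSum _ fun j hj => (hi j hj).indicator (hX.measurableSet_success ht j c)]
  refine Finset.sum_congr rfl fun j hj => ?_
  rw [integral_indicator (hX.measurableSet_success ht j c)]
  exact setIntegral_eq_mul_integral_of_indep (ℱ.le t)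
    (mul_nonneg (hφ j) (mul_nonneg (sw.q_pos hc).le (sw.v_pos c).le))
    (fun A hA => hX.measure_inter_success hφ ht j hc hA)
    (Measurable.ite (hm j hj) hU measurable_const)

/-- The expected one-step change of a function of the age of `r` and of the requests ahead of `r`,
in terms of the requests that the policy would schedule for the different indices. -/
theorem drift [IsProbabilityMeasure P] (hX : X.IsMMA P ℱ sw subsets φ) (hφ : ∀ j, 0 ≤ φ j)
    {t : ℕ} (ht : 1 ≤ t) {l : ℕ} {r : Fin R} (hr : r ∈ sw.requests l)
    (G : ℕ → Finset (Fin R) → ℝ) :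
    ∫ ω, G (X.age sw subsets r (t + 1) ω) (X.ahead sw subsets l r (t + 1) ω) ∂P =
      ∫ ω, (G (X.age sw subsets r t ω + 1) (X.ahead sw subsets l r t ω) +
        ∑ j ∈ Finset.univ.filter (fun j => l ∈ subsets j),
          φ j * (sw.q l * sw.v (X.choice t j l ω)) * jump (sw.requests l) r G (X.choice t j l ω)
            (X.age sw subsets r t ω) (X.ahead sw subsets l r t ω)) ∂P := by
  classical
  have hJm := fun c => hX.measurable_state ht l r (jump (sw.requests l) r G c)
  have hJi := fun c => hX.integrable_state ht l r (jump (sw.requests l) r G c)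
  have hSi : ∀ c, Integrable (fun ω => if X.Served sw subsets t c ω then
      jump (sw.requests l) r G c (X.age sw subsets r t ω) (X.ahead sw subsets l r t ω)
      else 0) P := fun c =>
    ((hJi c).indicator (ℱ.le (t + 1) _ (hX.measurableSet_served ht c))).congr
      (.of_forall fun ω => by simp [Set.indicator_apply])
  have h0 := hX.integrable_state ht l r fun h S => G (h + 1) S
  simp_rw [hX.step ht hr G]
  rw [integral_add h0 (integrable_finsetSum _ fun c _ => hSi c),
    integral_add h0 (integrable_finsetSum _ fun j hj => hX.integrable_choice_state ht r
      (Finset.mem_filter.1 hj).2 fun c h S => φ j * (sw.q l * sw.v c) *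
        jump (sw.requests l) r G c h S),
    integral_finsetSum _ fun c _ => hSi c,
    integral_finsetSum _ fun j hj => hX.integrable_choice_state ht r
      (Finset.mem_filter.1 hj).2 fun c h S => φ j * (sw.q l * sw.v c) *
        jump (sw.requests l) r G c h S]
  congr 1
  rw [Finset.sum_congr rfl fun c hc => hX.integral_served hφ ht hc (hJm c) (hJi c),
    Finset.sum_comm]
  refine Finset.sum_congr rfl fun j hj => ?_
  have hj' := (Finset.mem_filter.1 hj).2
  simp_rw [← integral_const_mul]
  rw [← integral_finsetSum _ fun c _ => hX.integrable_choice_state ht r hj' fun d h S =>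
    φ j * (sw.q l * sw.v c) * if d = c then jump (sw.requests l) r G c h S else 0]
  refine integral_congr_ae (.of_forall fun ω => ?_)
  dsimp only
  rw [Finset.sum_eq_single_of_mem _ (hX.choice_mem t ht j l hj' ω) fun c _ hc => by
    rw [if_neg hc.symm, mul_zero], if_pos rfl]

end IsMMA

end SwitchRun

/-! ### A Cesàro limit from a telescoping sum -/

/-- If `e t` differs from `D` by the increment of a bounded sequence `F` and a null sequence, then
the averages of `e` converge to `D`. -/
theorem tendsto_average_of_telescoping {F e : ℕ → ℝ} {D M : ℝ}
    (hF : ∀ t, 1 ≤ t → |F t| ≤ M) (he : ∀ t, 1 ≤ t → |F (t + 1) - F t - (D - e t)| ≤ M / t) :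
    Filter.Tendsto (fun T : ℕ => (∑ t ∈ Finset.Icc 1 T, e t) / T) Filter.atTop (nhds D) := by
  have hu : Filter.Tendsto (fun i : ℕ => e (i + 1) + (F (i + 2) - F (i + 1))) Filter.atTop
      (nhds D) := by
    rw [tendsto_iff_dist_tendsto_zero]
    refine squeeze_zero (fun _ => dist_nonneg) (fun i => ?_)
      ((tendsto_const_div_atTop_nhds_zero_nat M).comp (Filter.tendsto_add_atTop_nat 1))
    rw [Real.dist_eq]
    convert he (i + 1) (by omega) using 2
    · ring
    · rfl
  have hb : Filter.Tendsto (fun T : ℕ => (F (T + 1) - F 1) / T) Filter.atTop (nhds 0) := by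
    refine squeeze_zero_norm (fun T => ?_) (tendsto_const_div_atTop_nhds_zero_nat (2 * M))
    rw [norm_div, Real.norm_natCast, Real.norm_eq_abs]
    gcongr
    calc |F (T + 1) - F 1| ≤ |F (T + 1)| + |F 1| := abs_sub _ _
      _ ≤ M + M := add_le_add (hF _ (by omega)) (hF _ le_rfl)
      _ = 2 * M := by ring
  have hd := hu.cesaro.sub hb
  rw [sub_zero] at hd
  refine hd.congr fun T => ?_
  have hsum : ∑ t ∈ Finset.Icc 1 T, e t = ∑ i ∈ Finset.range T, e (i + 1) := by
    rw [Finset.range_eq_Ico, Finset.sum_Ico_add' e 0 T 1]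
    rfl
  rw [Finset.sum_add_distrib, Finset.sum_range_sub fun i => F (i + 1), hsum]
  ring

/-! ### The potential that solves the Poisson equation -/

/-- With `a c` the mean time to serve request `c` when it is the oldest, `S` the requests to be
served up to and including `r`, and `h` the age of `r`, the time `W` until `r` is served is a sum of
independent geometric variables, and the potential is the expectation of the total of `age - D`
over these slots, that is, of `h * W + W * (W - 1) / 2 - D * W`. -/
noncomputable def agePotential {ι : Type*} (a : ι → ℝ) (D : ℝ) (h : ℕ) (S : Finset ι) : ℝ :=
  h * ∑ c ∈ S, a c + ((∑ c ∈ S, a c) ^ 2 + ∑ c ∈ S, a c ^ 2 - 2 * ∑ c ∈ S, a c) / 2 -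
    D * ∑ c ∈ S, a c

theorem agePotential_empty {ι : Type*} (a : ι → ℝ) (D : ℝ) (h : ℕ) :
    agePotential a D h ∅ = 0 := by
  simp [agePotential]

/-- A full cycle has zero potential for the right value of the average age. -/
theorem agePotential_cycle {ι : Type*} {a : ι → ℝ} {C : Finset ι} (hC : ∑ c ∈ C, a c ≠ 0) :
    agePotential a (((∑ c ∈ C, a c) ^ 2 + ∑ c ∈ C, a c ^ 2) / (2 * ∑ c ∈ C, a c)) 1 C = 0 := by
  unfold agePotential
  field_simp
  push_cast
  ring

theorem agePotential_succ {ι : Type*} (a : ι → ℝ) (D : ℝ) (h : ℕ) (S : Finset ι) :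
    agePotential a D (h + 1) S = agePotential a D h S + ∑ c ∈ S, a c := by
  unfold agePotential
  push_cast
  ring

theorem agePotential_erase_sub {ι : Type*} [DecidableEq ι] (a : ι → ℝ) (D : ℝ) (h : ℕ)
    {S : Finset ι} {c : ι} (hc : c ∈ S) :
    agePotential a D (h + 1) (S.erase c) - agePotential a D (h + 1) S =
      -(a c * (h + ∑ d ∈ S, a d - D)) := by
  unfold agePotential
  rw [Finset.sum_erase_eq_sub hc, Finset.sum_erase_eq_sub hc]
  push_cast
  ring

theorem exists_agePotential_bound {ι : Type*} [Fintype ι] (a : ι → ℝ) (D : ℝ) :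
    ∃ K, 0 ≤ K ∧ ∀ h : ℕ, 1 ≤ h → ∀ S : Finset ι, |agePotential a D h S| ≤ K * h := by
  let A : Finset ι → ℝ := fun S => ∑ c ∈ S, a c
  let B : Finset ι → ℝ := fun S =>
    ((∑ c ∈ S, a c) ^ 2 + ∑ c ∈ S, a c ^ 2 - 2 * ∑ c ∈ S, a c) / 2 - D * ∑ c ∈ S, a c
  refine ⟨∑ S, (|A S| + |B S|), Finset.sum_nonneg fun _ _ => by positivity, fun h hh S => ?_⟩
  have h1 : (1 : ℝ) ≤ h := by exact_mod_cast hh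
  calc |agePotential a D h S| = |h * A S + B S| := by rw [agePotential, add_sub_assoc]
    _ ≤ h * |A S| + |B S| := by
      refine (abs_add_le _ _).trans_eq ?_
      rw [abs_mul, Nat.abs_cast]
    _ ≤ h * |A S| + h * |B S| := by
      gcongr
      exact le_mul_of_one_le_left (abs_nonneg _) h1
    _ = (|A S| + |B S|) * h := by ring
    _ ≤ _ := by
      gcongr
      exact Finset.single_le_sum (f := fun S => |A S| + |B S|)
        (fun _ _ => by positivity) (Finset.mem_univ S)

namespace SwitchRun

namespace IsMMA

variable {N R n : ℕ} {Ω : Type*} {X : SwitchRun N R n Ω} [mΩ : MeasurableSpace Ω] {P : Measure Ω}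
  {ℱ : Filtration ℕ mΩ} {sw : QuantumSwitch N R} {subsets : Fin n → Finset ℕ} {φ : Fin n → ℝ}

/-! ### Bounded second moments of the ages -/

/-- The ages have bounded second moments: `x ^ h * 2 ^ #S`, for `x` slightly above `1`, `h` the age
of `r` and `S` the set of requests ahead of `r`, is contracted on average up to a constant. -/
theorem exists_second_moment_bound [IsProbabilityMeasure P] (hX : X.IsMMA P ℱ sw subsets φ)
    (hφ : φ ∈ stdSimplex ℝ (Fin n)) {l : ℕ} {r : Fin R} (hr : r ∈ sw.requests l)
    (hθ : 0 < theta subsets φ l) :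
    ∃ K, 0 ≤ K ∧ ∀ t, 1 ≤ t → ∫ ω, (X.age sw subsets r t ω : ℝ) ^ 2 ∂P ≤ K := by
  obtain ⟨c₀, hc₀, hmin⟩ := Finset.exists_min_image (sw.requests l) sw.v ⟨r, hr⟩
  have hq := sw.q_pos hr
  have hq1 := sw.q_le_one hr
  have hθ1 : theta subsets φ l ≤ 1 :=
    (Finset.sum_le_univ_sum_of_nonneg hφ.1).trans_eq hφ.2
  -- a lower bound on the conditional probability that some request of cardinality `l` is served
  set s : ℝ := theta subsets φ l * (sw.q l * sw.v c₀) with hs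
  have hs0 : 0 < s := mul_pos hθ (mul_pos hq (sw.v_pos c₀))
  have hs1 : s ≤ 1 := mul_le_one₀ hθ1 (mul_pos hq (sw.v_pos c₀)).le
    (mul_le_one₀ hq1 (sw.v_pos c₀).le (sw.v_le_one c₀))
  -- a square, so that Bernoulli's inequality makes `x ^ h` at least a multiple of `h ^ 2`
  set x : ℝ := (1 + s / 8) ^ 2 with hx
  have hx1 : 1 ≤ x := one_le_pow₀ (by linarith)
  have hcontr : (1 - s / 2) * x ≤ 1 - s / 8 := by
    rw [hx]; nlinarith [mul_pos hs0 hs0, mul_pos (mul_pos hs0 hs0) hs0]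
  set Z : ℕ → Finset (Fin R) → ℝ := fun h S => x ^ h * 2 ^ S.card with hZ
  have hZ0 : ∀ h S, 0 ≤ Z h S := fun h S => by positivity
  set B : ℝ := x * 2 ^ (sw.requests l).card with hB
  have hB0 : 0 ≤ B := by positivity
  have hjump : ∀ c h S, c ∈ S → jump (sw.requests l) r Z c h S ≤ B - 1 / 2 * Z (h + 1) S := by
    intro c h S hc
    have := hZ0 (h + 1) S
    unfold jump
    split_ifs with hcr
    · simp only [hZ, hB, pow_one] at this ⊢
      linarith
    · have h2 : Z (h + 1) (S.erase c) = 1 / 2 * Z (h + 1) S := by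
        simp only [hZ]
        rw [← Finset.card_erase_add_one hc, pow_succ 2]
        ring
      rw [h2]
      linarith
  have hstep : ∀ t, 1 ≤ t →
      ∫ ω, Z (X.age sw subsets r (t + 1) ω) (X.ahead sw subsets l r (t + 1) ω) ∂P ≤
        (1 - s / 8) * ∫ ω, Z (X.age sw subsets r t ω) (X.ahead sw subsets l r t ω) ∂P + B := by
    intro t ht
    have hi := hX.integrable_state ht l r Z
    rw [hX.drift hφ.1 ht hr Z, ← integral_const_mul]
    have hBi : ∫ _, B ∂P = B := by simp
    rw [← hBi, ← integral_add (hi.const_mul _) (integrable_const _)]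
    refine integral_mono ((hX.integrable_state ht l r fun h S => Z (h + 1) S).add
      (integrable_finsetSum _ fun j hj => hX.integrable_choice_state ht r
        (Finset.mem_filter.1 hj).2 fun c h S => φ j * (sw.q l * sw.v c) *
          jump (sw.requests l) r Z c h S)) ((hi.const_mul _).add (integrable_const _)) fun ω => ?_
    dsimp only
    set h := X.age sw subsets r t ω
    set S := X.ahead sw subsets l r t ω
    set w := ∑ j ∈ Finset.univ.filter (fun j => l ∈ subsets j),
      φ j * (sw.q l * sw.v (X.choice t j l ω)) with hw
    have hw0 : s ≤ w := by
      rw [hs, hw, theta, Finset.sum_mul]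
      refine Finset.sum_le_sum fun j hj => mul_le_mul_of_nonneg_left
        (mul_le_mul_of_nonneg_left (hmin _ ?_) hq.le) (hφ.1 j)
      exact hX.choice_mem t ht j l (Finset.mem_filter.1 hj).2 ω
    have hw1 : w ≤ 1 := by
      refine le_trans (Finset.sum_le_sum fun j _ => ?_) hθ1
      exact mul_le_of_le_one_right (hφ.1 j) (mul_le_one₀ hq1 (sw.v_pos _).le (sw.v_le_one _))
    have hsum : ∑ j ∈ Finset.univ.filter (fun j => l ∈ subsets j),
        φ j * (sw.q l * sw.v (X.choice t j l ω)) *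
          jump (sw.requests l) r Z (X.choice t j l ω) h S ≤ w * (B - 1 / 2 * Z (h + 1) S) := by
      rw [hw, Finset.sum_mul]
      refine Finset.sum_le_sum fun j hj => mul_le_mul_of_nonneg_left (hjump _ _ _ ?_)
        (mul_nonneg (hφ.1 j) (mul_pos hq (sw.v_pos _)).le)
      exact hX.choice_mem_ahead ht hr (Finset.mem_filter.1 hj).2 ω
    have hsucc : Z (h + 1) S = x * Z h S := by
      simp only [hZ]; ring
    have e1 : w * B ≤ B := mul_le_of_le_one_left hB0 hw1
    have e2 : s * Z (h + 1) S ≤ w * Z (h + 1) S := mul_le_mul_of_nonneg_right hw0 (hZ0 _ _)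
    have e3 : (1 - s / 2) * x * Z h S ≤ (1 - s / 8) * Z h S :=
      mul_le_mul_of_nonneg_right hcontr (hZ0 _ _)
    rw [hsucc] at hsum e2 ⊢
    linarith
  set M : ℝ := ∫ ω, Z (X.age sw subsets r 1 ω) (X.ahead sw subsets l r 1 ω) ∂P + 8 / s * B with hM
  have hM1 : 0 ≤ ∫ ω, Z (X.age sw subsets r 1 ω) (X.ahead sw subsets l r 1 ω) ∂P :=
    integral_nonneg fun ω => hZ0 _ _
  have hM2 : 0 ≤ 8 / s * B := by positivity
  have hbound : ∀ t, 1 ≤ t →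
      ∫ ω, Z (X.age sw subsets r t ω) (X.ahead sw subsets l r t ω) ∂P ≤ M := by
    intro t ht
    induction t, ht using Nat.le_induction with
    | base => linarith
    | succ t ht ih =>
      refine (hstep t ht).trans ?_
      have e1 : B ≤ s / 8 * M := by
        have : B = s / 8 * (8 / s * B) := by field_simp
        rw [this]
        exact mul_le_mul_of_nonneg_left (by linarith) (by positivity)
      have e2 := mul_le_mul_of_nonneg_left ih (show 0 ≤ 1 - s / 8 by linarith)
      linarith
  refine ⟨64 / s ^ 2 * M, by positivity, fun t ht => ?_⟩
  refine le_trans ?_ (mul_le_mul_of_nonneg_left (hbound t ht) (by positivity))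
  rw [← integral_const_mul]
  refine integral_mono (hX.integrable_state ht l r fun h _ => (h : ℝ) ^ 2)
    ((hX.integrable_state ht l r Z).const_mul _) fun ω => ?_
  dsimp only
  set h := X.age sw subsets r t ω
  set S := X.ahead sw subsets l r t ω
  have hb : h * (s / 8) ≤ (1 + s / 8) ^ h := by
    have := one_add_mul_le_pow (show -2 ≤ s / 8 by linarith) h
    linarith
  have hp : (h * (s / 8)) ^ 2 ≤ x ^ h := by
    rw [hx, ← pow_mul, mul_comm 2, pow_mul]
    exact pow_le_pow_left₀ (by positivity) hb 2
  have hz : x ^ h ≤ Z h S := le_mul_of_one_le_right (by positivity) (one_le_pow₀ (by norm_num))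
  calc (h : ℝ) ^ 2 = 64 / s ^ 2 * (h * (s / 8)) ^ 2 := by field_simp; norm_num
    _ ≤ 64 / s ^ 2 * Z h S := mul_le_mul_of_nonneg_left (hp.trans hz) (by positivity)

/-! ### The average age -/

/-- The Poisson equation along every path. It is exact unless some index would schedule `r` while
another request is as old, which requires that `r` has never been served, so that its age is `t`. -/
theorem abs_potential_drift_sub_le (hX : X.IsMMA P ℱ sw subsets φ)
    (hφ : φ ∈ stdSimplex ℝ (Fin n)) {l : ℕ} {r : Fin R} (hr : r ∈ sw.requests l)
    (hθ : 0 < theta subsets φ l) {a : Fin R → ℝ} {D K : ℝ} (hK : 0 ≤ K)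
    (ha : ∀ c, a c = 1 / (theta subsets φ l * sw.q l * sw.v c))
    (hcycle : agePotential a D 1 (sw.requests l) = 0)
    (hbound : ∀ h : ℕ, 1 ≤ h → ∀ S, |agePotential a D h S| ≤ K * h) {t : ℕ} (ht : 1 ≤ t) (ω : Ω) :
    |agePotential a D (X.age sw subsets r t ω + 1) (X.ahead sw subsets l r t ω) +
        ∑ j ∈ Finset.univ.filter (fun j => l ∈ subsets j),
          φ j * (sw.q l * sw.v (X.choice t j l ω)) * jump (sw.requests l) r (agePotential a D)
            (X.choice t j l ω) (X.age sw subsets r t ω) (X.ahead sw subsets l r t ω) -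
      (agePotential a D (X.age sw subsets r t ω) (X.ahead sw subsets l r t ω) +
        (D - X.age sw subsets r t ω))| ≤ 2 * K / t * (X.age sw subsets r t ω : ℝ) ^ 2 := by
  set h := X.age sw subsets r t ω with hh
  set S := X.ahead sw subsets l r t ω with hS
  set J := Finset.univ.filter fun j => l ∈ subsets j with hJ
  have hq := sw.q_pos hr
  have hθ1 : theta subsets φ l ≤ 1 :=
    (Finset.sum_le_univ_sum_of_nonneg hφ.1).trans_eq hφ.2
  -- a service of `r` leads to zero potential instead of that of the remaining set, which is empty
  -- unless there is a tie
  set err : Fin R → ℝ := fun c => if c = r then agePotential a D (h + 1) (S.erase r) else 0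
    with herr
  have hterm : ∀ j ∈ J, φ j * (sw.q l * sw.v (X.choice t j l ω)) *
      jump (sw.requests l) r (agePotential a D) (X.choice t j l ω) h S =
        -(φ j * ((h + ∑ d ∈ S, a d - D) / theta subsets φ l)) -
          φ j * (sw.q l * sw.v (X.choice t j l ω)) * err (X.choice t j l ω) := by
    intro j hj
    have hc : X.choice t j l ω ∈ S := hX.choice_mem_ahead ht hr (Finset.mem_filter.1 hj).2 ω
    set c := X.choice t j l ω
    have hjc : jump (sw.requests l) r (agePotential a D) c h S =
        -(a c * (h + ∑ d ∈ S, a d - D)) - err c := by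
      rw [← agePotential_erase_sub a D h hc, jump, herr]
      dsimp only
      split_ifs with hcr
      · rw [hcycle, hcr]
        ring
      · ring
    have hv := (sw.v_pos c).ne'
    have hac : sw.q l * sw.v c * a c = 1 / theta subsets φ l := by
      rw [ha]
      field_simp
    rw [hjc]
    linear_combination (-(φ j * (h + ∑ d ∈ S, a d - D))) * hac
  have hsum : ∑ j ∈ J, φ j * ((h + ∑ d ∈ S, a d - D) / theta subsets φ l) =
      h + ∑ d ∈ S, a d - D := by
    rw [← Finset.sum_mul, ← theta]
    field_simp
  rw [Finset.sum_congr rfl hterm, Finset.sum_sub_distrib, Finset.sum_neg_distrib, hsum,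
    agePotential_succ]
  have hE : ∀ j ∈ J, |err (X.choice t j l ω)| ≤ 2 * K / t * (h : ℝ) ^ 2 := by
    intro j hj
    have hj' := (Finset.mem_filter.1 hj).2
    have hnn : 0 ≤ 2 * K / t * (h : ℝ) ^ 2 := by positivity
    simp only [herr]
    split_ifs with hcr
    · rcases (X.age_le sw subsets r t ω).lt_or_eq with hlt | heq
      · rw [hS, hX.ahead_erase_eq_empty ht hr hj' hcr hlt, agePotential_empty, abs_zero]
        exact hnn
      -- at `h = t` the linear bound `K * (h + 1)` is at most `2 * K * h ^ 2 / t`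
      · refine (hbound (h + 1) (by omega) _).trans ?_
        have ht1 : (1 : ℝ) ≤ t := by exact_mod_cast ht
        rw [show h = t from heq]
        push_cast
        have : 2 * K / t * (t : ℝ) ^ 2 = K * (2 * t) := by field_simp
        rw [this]
        exact mul_le_mul_of_nonneg_left (by linarith) hK
    · simpa using hnn
  have hdiff : ∀ u y z E : ℝ, u + z + (-(y + z - D) - E) - (u + (D - y)) = -E :=
    fun u y z E => by ring
  rw [hdiff, abs_neg]
  refine (Finset.abs_sum_le_sum_abs _ _).trans ?_
  refine (Finset.sum_le_sum (g := fun j => φ j * (2 * K / t * (h : ℝ) ^ 2)) fun j hj => ?_).trans ?_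
  · have hw := mul_pos hq (sw.v_pos (X.choice t j l ω))
    rw [abs_mul, abs_mul, abs_of_nonneg (hφ.1 j), abs_of_pos hw, mul_assoc]
    refine mul_le_mul_of_nonneg_left ?_ (hφ.1 j)
    exact (mul_le_of_le_one_left (abs_nonneg _)
      (mul_le_one₀ (sw.q_le_one hr) (sw.v_pos _).le (sw.v_le_one _))).trans (hE j hj)
  · rw [← Finset.sum_mul]
    exact mul_le_of_le_one_left (by positivity) hθ1

theorem tendsto_average [IsProbabilityMeasure P] (hX : X.IsMMA P ℱ sw subsets φ)
    (hφ : φ ∈ stdSimplex ℝ (Fin n)) {l : ℕ} {r : Fin R} (hr : r ∈ sw.requests l)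
    (hθ : 0 < theta subsets φ l) :
    Filter.Tendsto
      (fun T : ℕ => (∑ t ∈ Finset.Icc 1 T, ∫ ω, (X.age sw subsets r t ω : ℝ) ∂P) / T) Filter.atTop
      (nhds ((1 / sw.beta l * (∑ c ∈ sw.requests l, 1 / sw.v c ^ 2) + sw.beta l) /
        (2 * theta subsets φ l * sw.q l))) := by
  have hq := sw.q_pos hr
  have hβ : 0 < sw.beta l :=
    Finset.sum_pos (fun c _ => one_div_pos.2 (sw.v_pos c)) ⟨r, hr⟩
  set a : Fin R → ℝ := fun c => 1 / (theta subsets φ l * sw.q l * sw.v c) with ha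
  have hA : ∑ c ∈ sw.requests l, a c = sw.beta l / (theta subsets φ l * sw.q l) := by
    rw [QuantumSwitch.beta, Finset.sum_div]
    exact Finset.sum_congr rfl fun c _ => by rw [div_div, mul_comm (sw.v c)]
  have hA2 : ∑ c ∈ sw.requests l, a c ^ 2 =
      (∑ c ∈ sw.requests l, 1 / sw.v c ^ 2) / (theta subsets φ l * sw.q l) ^ 2 := by
    rw [Finset.sum_div]
    refine Finset.sum_congr rfl fun c _ => ?_
    rw [div_div, div_pow, one_pow, mul_pow _ (sw.v c), mul_comm (sw.v c ^ 2)]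
  set D : ℝ := ((∑ c ∈ sw.requests l, a c) ^ 2 + ∑ c ∈ sw.requests l, a c ^ 2) /
    (2 * ∑ c ∈ sw.requests l, a c) with hD
  have hDeq : (1 / sw.beta l * (∑ c ∈ sw.requests l, 1 / sw.v c ^ 2) + sw.beta l) /
      (2 * theta subsets φ l * sw.q l) = D := by
    rw [hD, hA, hA2]
    field_simp
    ring
  have hcycle : agePotential a D 1 (sw.requests l) = 0 :=
    agePotential_cycle (by rw [hA]; positivity)
  obtain ⟨K, hK, hbound⟩ := exists_agePotential_bound a D
  obtain ⟨K', hK', hmom⟩ := hX.exists_second_moment_bound hφ hr hθ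
  rw [hDeq]
  have hKK : 0 ≤ K * K' := mul_nonneg hK hK'
  refine tendsto_average_of_telescoping (M := 2 * K * K') (F := fun t =>
    ∫ ω, agePotential a D (X.age sw subsets r t ω) (X.ahead sw subsets l r t ω) ∂P)
    (fun t ht => ?_) fun t ht => ?_
  · refine (abs_integral_le_integral_abs).trans ?_
    have hle : ∫ ω, |agePotential a D (X.age sw subsets r t ω) (X.ahead sw subsets l r t ω)| ∂P ≤
        ∫ ω, K * (X.age sw subsets r t ω : ℝ) ^ 2 ∂P := by
      refine integral_mono (hX.integrable_state ht l r fun h S => |agePotential a D h S|)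
        (hX.integrable_state ht l r fun h _ => K * (h : ℝ) ^ 2) fun ω => ?_
      have h1 := X.one_le_age sw subsets r ht ω
      refine (hbound _ h1 _).trans (mul_le_mul_of_nonneg_left ?_ hK)
      exact le_self_pow₀ (by exact_mod_cast h1) two_ne_zero
    rw [integral_const_mul] at hle
    have := mul_le_mul_of_nonneg_left (hmom t ht) hK
    linarith
  · have hi := hX.integrable_state ht l r (agePotential a D)
    have hih := hX.integrable_state ht l r fun h _ => (D - h : ℝ)
    have hit := (hX.integrable_state ht l r fun h S => agePotential a D (h + 1) S).add
      (integrable_finsetSum (Finset.univ.filter fun j => l ∈ subsets j) fun j hj =>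
        hX.integrable_choice_state ht r (Finset.mem_filter.1 hj).2 fun c h S =>
          φ j * (sw.q l * sw.v c) * jump (sw.requests l) r (agePotential a D) c h S)
    have his := hi.add hih
    simp only [Pi.add_def] at hit his
    have hDh : D - ∫ ω, (X.age sw subsets r t ω : ℝ) ∂P =
        ∫ ω, (D - X.age sw subsets r t ω : ℝ) ∂P := by
      rw [integral_sub (integrable_const _) (hX.integrable_state ht l r fun h _ => (h : ℝ))]
      simp
    rw [hX.drift hφ.1 ht hr, hDh, sub_sub, ← integral_add hi hih,
      ← integral_sub hit his]
    refine (abs_integral_le_integral_abs).trans ?_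
    calc _ ≤ ∫ ω, 2 * K / t * (X.age sw subsets r t ω : ℝ) ^ 2 ∂P :=
        integral_mono (hit.sub his).abs
          (hX.integrable_state ht l r fun h _ => 2 * K / t * (h : ℝ) ^ 2) fun ω =>
            hX.abs_potential_drift_sub_le hφ hr hθ hK (fun c => rfl) hcycle hbound ht ω
      _ ≤ 2 * K / t * K' := by
        rw [integral_const_mul]
        exact mul_le_mul_of_nonneg_left (hmom t ht) (by positivity)
      _ = 2 * K * K' / t := by ring

/-- Without service the age grows by one in each slot. -/
theorem integral_age_of_theta_eq_zero [IsProbabilityMeasure P] (hX : X.IsMMA P ℱ sw subsets φ)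
    (hφ : φ ∈ stdSimplex ℝ (Fin n)) {l : ℕ} {r : Fin R} (hr : r ∈ sw.requests l)
    (hθ : theta subsets φ l = 0) {t : ℕ} (ht : 1 ≤ t) :
    ∫ ω, (X.age sw subsets r t ω : ℝ) ∂P = t := by
  have hz := (Finset.sum_eq_zero_iff_of_nonneg fun j _ => hφ.1 j).1 hθ
  induction t, ht using Nat.le_induction with
  | base => simp [age_one]
  | succ t ht ih =>
    rw [hX.drift hφ.1 ht hr fun h _ => (h : ℝ)]
    have hpt : ∀ ω, ((X.age sw subsets r t ω + 1 : ℕ) : ℝ) +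
        ∑ j ∈ Finset.univ.filter (fun j => l ∈ subsets j),
          φ j * (sw.q l * sw.v (X.choice t j l ω)) * jump (sw.requests l) r (fun h _ => (h : ℝ))
            (X.choice t j l ω) (X.age sw subsets r t ω) (X.ahead sw subsets l r t ω) =
        X.age sw subsets r t ω + 1 := fun ω => by
      rw [Finset.sum_eq_zero fun j hj => by rw [hz j hj, zero_mul, zero_mul], add_zero,
        Nat.cast_add_one]
    simp_rw [hpt]
    rw [integral_add (hX.integrable_state ht l r fun h _ => (h : ℝ)) (integrable_const _), ih]
    simp

theorem averageAge_eq_limsup [IsProbabilityMeasure P] (hX : X.IsMMA P ℱ sw subsets φ)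
    (r : Fin R) :
    X.averageAge P sw subsets r = Filter.limsup (fun T : ℕ => ENNReal.ofReal
      ((∑ t ∈ Finset.Icc 1 T, ∫ ω, (X.age sw subsets r t ω : ℝ) ∂P) / T)) Filter.atTop := by
  refine Filter.limsup_congr ?_
  filter_upwards [Filter.eventually_ge_atTop 1] with T hT
  rw [ENNReal.ofReal_div_of_pos (by exact_mod_cast hT), ENNReal.ofReal_natCast,
    ENNReal.ofReal_sum_of_nonneg fun t _ => integral_nonneg fun ω => Nat.cast_nonneg _]
  congr 1
  refine Finset.sum_congr rfl fun t ht => ?_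
  rw [ofReal_integral_eq_lintegral_ofReal
    (hX.integrable_state (Finset.mem_Icc.1 ht).1 0 r fun h _ => (h : ℝ))
    (.of_forall fun ω => Nat.cast_nonneg _)]
  simp_rw [ENNReal.ofReal_natCast]

end IsMMA

end SwitchRun

theorem lemma2 {N R n : ℕ} (sw : QuantumSwitch N R) (subsets : Fin n → Finset ℕ)
    (hsubsets : ∀ i, sw.IsMaximalFeasible (subsets i))
    (φ : Fin n → ℝ) (hφ : φ ∈ stdSimplex ℝ (Fin n))
    {Ω : Type*} [mΩ : MeasurableSpace Ω] (P : Measure Ω) [IsProbabilityMeasure P]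
    (ℱ : Filtration ℕ mΩ) (X : SwitchRun N R n Ω) (hX : X.IsMMA P ℱ sw subsets φ)
    (l : ℕ) (r : Fin R) (hr : r ∈ sw.requests l) :
    X.averageAge P sw subsets r =
      ENNReal.ofReal
          (1 / sw.beta l * (∑ r' ∈ sw.requests l, 1 / sw.v r' ^ 2) + sw.beta l) /
        ENNReal.ofReal (2 * theta subsets φ l * sw.q l) := by
  have hq := sw.q_pos hr
  rw [hX.averageAge_eq_limsup]
  have hθ0 : 0 ≤ theta subsets φ l := Finset.sum_nonneg fun j _ => hφ.1 j
  rcases hθ0.eq_or_lt with hθ | hθ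
  · have hβ : 0 < sw.beta l :=
      Finset.sum_pos (fun c _ => one_div_pos.2 (sw.v_pos c)) ⟨r, hr⟩
    have hnum : 0 < 1 / sw.beta l * (∑ r' ∈ sw.requests l, 1 / sw.v r' ^ 2) + sw.beta l :=
      add_pos_of_nonneg_of_pos (mul_nonneg (one_div_nonneg.2 hβ.le)
        (Finset.sum_nonneg fun c _ => by positivity)) hβ
    rw [← hθ, mul_zero, zero_mul, ENNReal.ofReal_zero,
      ENNReal.div_zero (ENNReal.ofReal_pos.2 hnum).ne']
    refine (ENNReal.tendsto_ofReal_nhds_top.2 ?_).limsup_eq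
    have hgrow : Filter.Tendsto (fun T : ℕ => (T : ℝ) / 2) Filter.atTop Filter.atTop :=
      tendsto_natCast_atTop_atTop.atTop_div_const two_pos
    refine Filter.tendsto_atTop_mono' _ ?_ hgrow
    filter_upwards [Filter.eventually_ge_atTop 1] with T hT
    have hT' : (0 : ℝ) < T := by exact_mod_cast hT
    rw [Finset.sum_congr rfl fun t ht =>
      hX.integral_age_of_theta_eq_zero hφ hr hθ.symm (Finset.mem_Icc.1 ht).1, le_div_iff₀ hT']
    have hgauss : ∀ m : ℕ, (m : ℝ) / 2 * m ≤ ∑ t ∈ Finset.Icc 1 m, (t : ℝ) := by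
      intro m
      induction m with
      | zero => simp
      | succ m ih =>
        rw [Finset.sum_Icc_succ_top (by omega)]
        push_cast
        linarith
    exact hgauss T
  · rw [← ENNReal.ofReal_div_of_pos (by positivity)]
    exact (ENNReal.tendsto_ofReal (hX.tendsto_average hφ hr hθ)).limsup_eq
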